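/- **Model (MSB-PRS).** There are $M$ arms, $K$ plays and $T$ rounds. Play $k\in[K]$ has a priority weight $\alpha_k$, where $\alpha_1\ge\dots\ge\alpha_K>0$, and movement costs $c_{k,m}\in[0,\infty]$, $m \in [M]$. Arm $m\in[M]$ has an unknown capacity law $D_m$ supported in $\{1,\dots,d_{\max}\}$, and an unknown reward law $R_m$ on $\mathbb R$ with mean $\mu_m>0$ which is $\sigma$-subgaussian, i.e. $\mathbb E\, e^{\lambda(R_m-\mu_m)}\le e^{\lambda^2\sigma^2/2}$ for all $\lambda\in\mathbb R$. In each round $t$, capacities $D^{(t)}_m\sim D_m$ and unit rewards $R^{(t)}_{m,i}\sim R_m$ are drawn, all independent, and the decision maker chooses an action profile $a^{(t)}\in[M]^K$. The plays assigned to the same arm are ranked by decreasing weight (ties being broken by an arbitrary fixed rule, which may depend on the profile). If play $k$ has rank $\ell$ on its arm $m=a^{(t)}_k$, it receives $X^{(t)}_k=\alpha_k R^{(t)}_{m,\ell}$ if $\ell\le D^{(t)}_m$, and null (no reward) otherwise. The decision maker observes all $X^{(t)}_k$, and $D^{(t)}_m$ for those arms $m$ to which at least one play is assigned. Let $U(a)$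 be the expected total reward of one round with action profile $a$ minus the total movement cost $\sum_k c_{k,a_k}$, and let $$\mathrm{Reg}_T=\mathbb E\Big[\sum_{t=1}^T\big(\max_{b\in[M]^K} U(b)-U(a^{(t)})\big)\Big].$$ A learning algorithm knows $M$, $K$, $T$, $\sigma$, $d_{\max}$, the tie-breaking rule, and all weights and costs; it chooses $a^{(t)}$, possibly at random, depending on this knowledge and on the past profiles and observations only. **Theorem.** Let $M\ge2$, $K\ge1$, $T\ge1$, $\sigma\ge0$, $\alpha_1>0$. For every learning algorithm there is an MSB-PRS instance with $M$ arms, $K$ plays, largest weight $\alpha_1$ and $\sigma$-subgaussian rewards on which $$\mathrm{Reg}_T\ \ge\ \frac1{27}\,\alpha_1\,\sigma\,\sqrt{MKT}.$$ Moreover, if $\sigma>0$ and $KT\ge M-1$, there is such an instance with $0<\mu_m\le\sigma$ for all $m$. In particular, the instance-independent regret lower bound is $\Omega(\alpha_1\sigma\sqrt{MKT})$, with an absolute constant. -/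

import Mathlib

open MeasureTheory ProbabilityTheory
open scoped ENNReal NNReal

namespace MSB

/-- An action profile: play `k` is assigned to arm `a k`. -/
abbrev Profile (M K : ℕ) : Type := Fin K → Fin M

/-- A value that is either observed (`Sum.inl x`) or null (`Sum.inr ()`). -/
abbrev Nullable (α : Type) : Type := α ⊕ Unit

/-- What the decision maker sees in one round: the reward of each play (null if the play received
no capacity), and the capacity of each arm (null if no play was assigned to the arm). -/
abbrev Feedback (M K : ℕ) : Type := (Fin K → Nullable ℝ) × (Fin M → Nullable ℕ)

/-- The history of the first `t` rounds: the action profile and the feedback of each round. -/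
abbrev History (M K t : ℕ) : Type := Fin t → Profile M K × Feedback M K

/-- The part of an instance that is known to the decision maker. Plays are listed by
non-increasing priority weight; a movement cost `∞` says that the arm is unavailable to the play. -/
structure PublicData (M K : ℕ) where
  dmax : ℕ
  dmax_pos : 0 < dmax
  weight : Fin K → ℝ
  weight_pos : ∀ k, 0 < weight k
  weight_antitone : Antitone weight
  cost : Fin K → Fin M → ℝ≥0∞

/-- An instance with `M` arms and `K` plays: the public data, and for each arm the
unknown laws of its capacity, supported in `{1, …, dmax}`, and of its per-unit reward, which has
positive mean and is `σ`-subgaussian about its mean. -/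
structure Instance (M K : ℕ) (σ : ℝ≥0) extends PublicData M K where
  capLaw : Fin M → Measure ℕ
  capLaw_prob : ∀ m, IsProbabilityMeasure (capLaw m)
  capLaw_support : ∀ m, ∀ᵐ d ∂(capLaw m), 1 ≤ d ∧ d ≤ dmax
  rewardLaw : Fin M → Measure ℝ
  rewardLaw_prob : ∀ m, IsProbabilityMeasure (rewardLaw m)
  rewardLaw_subgaussian : ∀ m,
    HasSubgaussianMGF (fun x => x - ∫ y, y ∂(rewardLaw m)) (σ ^ 2) (rewardLaw m)
  rewardLaw_mean_pos : ∀ m, 0 < ∫ y, y ∂(rewardLaw m)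

attribute [instance] Instance.capLaw_prob Instance.rewardLaw_prob

/-- A tie-breaking rule: for each action profile, an order of the plays by which plays of equal
weight on the same arm are ranked. -/
abbrev TieRule (M K : ℕ) : Type := Profile M K → Equiv.Perm (Fin K)

/-- Play `j` precedes play `k` on their common arm. -/
def Precedes {M K : ℕ} (w : Fin K → ℝ) (ties : TieRule M K) (a : Profile M K)
    (j k : Fin K) : Prop :=
  a j = a k ∧ (w k < w j ∨ (w j = w k ∧ ties a j < ties a k))

open Classical in
/-- The rank of play `k` on its arm, counted from `0`: the number of plays that precede it. -/
noncomputable def rank {M K : ℕ} (w : Fin K → ℝ) (ties : TieRule M K) (a : Profile M K)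
    (k : Fin K) : Fin K :=
  ⟨(Finset.univ.filter fun j => Precedes w ties a j k).card, by
    have h : (Finset.univ.filter fun j => Precedes w ties a j k) ⊂ Finset.univ := by
      refine Finset.filter_ssubset.2 ⟨k, Finset.mem_univ k, ?_⟩
      simp [Precedes]
    simpa using Finset.card_lt_card h⟩

/-- The random quantities of one round: the capacity of each arm, and the reward of each unit
of capacity of each arm. As at most `K` plays share an arm, only the first `K` units are listed. -/
abbrev Table (M K : ℕ) : Type := (Fin M → ℕ) × (Fin M → Fin K → ℝ)

variable {M K : ℕ} {σ : ℝ≥0}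

/-- The reward of play `k` in a round with action profile `a`: with capacity `d` on its arm, the
plays of ranks `0, …, d - 1` get one unit of capacity each, and the others get null. -/
noncomputable def playReward (w : Fin K → ℝ) (ties : TieRule M K) (a : Profile M K)
    (ω : Table M K) (k : Fin K) : Nullable ℝ :=
  if (rank w ties a k : ℕ) < ω.1 (a k) then
    Sum.inl (w k * ω.2 (a k) (rank w ties a k))
  else Sum.inr ()

open Classical in
/-- The feedback of a round with action profile `a`. -/
noncomputable def observe (w : Fin K → ℝ) (ties : TieRule M K) (a : Profile M K)
    (ω : Table M K) : Feedback M K :=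
  (playReward w ties a ω,
    fun m => if ∃ k, a k = m then Sum.inl (ω.1 m) else Sum.inr ())

lemma measurable_observe (w : Fin K → ℝ) (ties : TieRule M K) (a : Profile M K) :
    Measurable (observe w ties a) := by
  unfold observe playReward
  refine Measurable.prodMk (measurable_pi_lambda _ fun k => ?_)
    (measurable_pi_lambda _ fun m => ?_)
  · refine Measurable.ite (measurableSet_lt measurable_const (by fun_prop))
      (measurable_inl.comp (by fun_prop)) measurable_const
  · split_ifs
    · exact measurable_inl.comp (by fun_prop)
    · exact measurable_const

namespace Instance

/-- The mean reward per unit of capacity on arm `m`. -/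
noncomputable def mean (I : Instance M K σ) (m : Fin M) : ℝ := ∫ y, y ∂(I.rewardLaw m)

/-- The law of the random quantities of one round: all capacities and rewards are independent. -/
noncomputable def tableLaw (I : Instance M K σ) : Measure (Table M K) :=
  (Measure.pi I.capLaw).prod (Measure.pi fun m => Measure.pi fun _ : Fin K => I.rewardLaw m)

instance (I : Instance M K σ) : IsProbabilityMeasure I.tableLaw := by
  unfold tableLaw; infer_instance

/-- Expected total reward from arm `m` in a round with action profile `a` (null counts as `0`). -/
noncomputable def expectedReward (I : Instance M K σ) (ties : TieRule M K) (a : Profile M K)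
    (m : Fin M) : ℝ :=
  ∫ ω, ∑ k, (if a k = m then Sum.elim id (fun _ => 0) (playReward I.weight ties a ω k) else 0)
    ∂I.tableLaw

/-- Expected utility of the action profile `a`: over all arms, expected reward minus movement
costs. It is `-∞` if some play is assigned to an arm that is unavailable to it. -/
noncomputable def utility (I : Instance M K σ) (ties : TieRule M K) (a : Profile M K) : EReal :=
  ∑ m, ((I.expectedReward ties a m : EReal)
    - ((∑ k, if a k = m then I.cost k m else 0 : ℝ≥0∞) : EReal))

/-- The utility gap between an optimal action profile and `a`. -/
noncomputable def gap (I : Instance M K σ) (ties : TieRule M K) (a : Profile M K) : ℝ≥0∞ :=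
  ((⨆ b, I.utility ties b) - I.utility ties a).toENNReal

/-- The law of the feedback of a round, given its action profile. -/
noncomputable def feedback (I : Instance M K σ) (ties : TieRule M K) :
    Kernel (Profile M K) (Feedback M K) :=
  Kernel.ofFunOfCountable fun a => I.tableLaw.map (observe I.weight ties a)

instance (I : Instance M K σ) (ties : TieRule M K) : IsMarkovKernel (I.feedback ties) :=
  ⟨fun a => Measure.isProbabilityMeasure_map (measurable_observe I.weight ties a).aemeasurable⟩

end Instance

/-- A (possibly randomized) policy: the conditional law of the action profile of the next round,
given the history of the past rounds. -/
structure Policy (M K : ℕ) where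
  act : (t : ℕ) → Kernel (History M K t) (Profile M K)
  act_markov : ∀ t, IsMarkovKernel (act t)

attribute [instance] Policy.act_markov

/-- A learning algorithm: it knows the public data, and chooses a policy. -/
abbrev Algorithm (M K : ℕ) : Type := PublicData M K → Policy M K

/-- The law of the history of the first `t` rounds when `π` is run on the instance `I`. In each
round, the action profile is drawn from the policy and then the feedback is drawn, with fresh
capacities and rewards. -/
noncomputable def historyLaw (I : Instance M K σ) (ties : TieRule M K) (π : Policy M K) :
    (t : ℕ) → Measure (History M K t)
  | 0 => Measure.dirac Fin.elim0
  | t + 1 =>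
    ((historyLaw I ties π t) ⊗ₘ
      ((π.act t) ⊗ₖ (Kernel.prodMkLeft (History M K t) (I.feedback ties)))).map
        fun p => Fin.snoc (α := fun _ => Profile M K × Feedback M K) p.1 p.2

/-- The regret after `T` rounds. -/
noncomputable def regret (I : Instance M K σ) (ties : TieRule M K) (π : Policy M K) (T : ℕ) :
    ℝ≥0∞ :=
  ∫⁻ h, ∑ t : Fin T, I.gap ties (h t).1 ∂(historyLaw I ties π T)

end MSB

/-!
The hard instances have equal weights `α`, capacities `K` and no costs. Then no play is ever
refused, and by `feedback_twoPointInstance` a round is nothing but `K` independent pulls of the arms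
that the profile names: ranks, ties and capacities carry no information. The problem is thus a
bandit with `M` arms and `n = K * T` pulls, where pulls come in batches, and the lower bound is the
minimax bound for bandits.

If all arms are equal, some arm `m` gets at most `n / M` pulls on average
(`exists_integral_totalOn_le`). The instance in which `m` is better by a lead of `Δ` is hard to tell
from this one, and each pull of another arm costs `α * Δ` (`le_gap_of_lead`). By
`lintegral_mul_prod_historyLaw_le`, a lower bound for the density of the feedback of one round
gives the product over the rounds as a lower bound for the density of the history, whatever the
policy; `le_regret_of_density` turns this into a lower bound for the regret.

* If `M ≤ n + 1`, the rewards take the values `c ± σ` with probabilities `1 / 2` each, and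
  `(1 ± p) / 2` on arm `m`, so that the lead is `σ * p`. The density `L` of the history is a product
  of factors `1 ± p`. Its relative entropy is at most `p ^ 2` times the mean number of pulls of `m`
  (`integral_sum_log_likelihood`, `neg_sq_le_half_log_add_log`), and a pointwise form of Pinsker's
  inequality (`sub_mul_ge`) bounds the effect of `L` on the number of pulls. With
  `p = √(M / n) / 5`, a fixed fraction of the pulls misses `m`, and the regret is of order
  `α * σ * p * n`, that is `α * σ * √(M * n)`.
* If `n + 1 < M`, then arm `m` is never pulled with probability at least `1 - n / M`, which is
  positive. On this event the two instances agree, and the regret is `α * Δ * n`, where `Δ` is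
  arbitrarily large (`exists_instance_of_few_plays`).
-/

namespace MSB

variable {M K : ℕ} {σ : ℝ≥0}

/-! ### Product measures -/

lemma lintegral_pi_prod {ι : Type*} [Fintype ι] {X : ι → Type*}
    [∀ i, MeasurableSpace (X i)] (μ : ∀ i, Measure (X i)) [∀ i, IsProbabilityMeasure (μ i)]
    {f : ∀ i, X i → ℝ≥0∞} (hf : ∀ i, Measurable (f i)) :
    ∫⁻ x, ∏ i, f i (x i) ∂(Measure.pi μ) = ∏ i, ∫⁻ x, f i x ∂(μ i) := by
  refine (lintegral_prod_eq_prod_lintegral_of_indepFun Finset.univ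
    (fun i (x : ∀ i, X i) => f i (x i)) (iIndepFun_pi fun i => (hf i).aemeasurable) fun i =>
      (hf i).comp (measurable_pi_apply i)).trans ?_
  refine Finset.prod_congr rfl fun i _ => ?_
  exact (measurePreserving_eval μ i).lintegral_comp (hf i)

lemma pi_withDensity {ι : Type*} [Fintype ι] {X : ι → Type*}
    [∀ i, MeasurableSpace (X i)] (μ : ∀ i, Measure (X i)) [∀ i, IsProbabilityMeasure (μ i)]
    {f : ∀ i, X i → ℝ≥0∞} (hf : ∀ i, Measurable (f i))
    [∀ i, IsProbabilityMeasure ((μ i).withDensity (f i))] :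
    Measure.pi (fun i => (μ i).withDensity (f i)) =
      (Measure.pi μ).withDensity fun x => ∏ i, f i (x i) := by
  refine Measure.pi_eq fun s hs => ?_
  rw [withDensity_apply _ (MeasurableSet.univ_pi hs), ← lintegral_indicator (.univ_pi hs)]
  simp_rw [withDensity_apply _ (hs _), ← lintegral_indicator (hs _)]
  rw [← lintegral_pi_prod μ fun i => (hf i).indicator (hs i)]
  refine lintegral_congr fun x => ?_
  by_cases hx : x ∈ Set.univ.pi s
  · rw [Set.indicator_of_mem hx]
    exact Finset.prod_congr rfl fun i _ => (Set.indicator_of_mem (hx i trivial) _).symm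
  · rw [Set.indicator_of_notMem hx]
    obtain ⟨i, hi⟩ : ∃ i, x i ∉ s i := by simpa [Set.mem_pi] using hx
    exact (Finset.prod_eq_zero (Finset.mem_univ i) (Set.indicator_of_notMem hi _)).symm

/-- Distinct entries of an array of independent variables, constant in law along the rows, are
independent with the laws of their rows. -/
lemma pi_pi_map_of_injective {ι κ ν : Type*} [Fintype ι] [Fintype κ] [Fintype ν]
    {X : Type*} [MeasurableSpace X] (μ : ι → Measure X) [∀ i, IsProbabilityMeasure (μ i)]
    (a : ν → ι) (r : ν → κ) (h : Function.Injective fun k => (a k, r k)) :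
    (Measure.pi fun i => Measure.pi fun _ : κ => μ i).map (fun R k => R (a k) (r k)) =
      Measure.pi fun k => μ (a k) := by
  have hc : (Measure.pi fun i => Measure.pi fun _ : κ => μ i) =
      (Measure.pi fun p : ι × κ => μ p.1).map (MeasurableEquiv.curry ι κ X) := by
    have := Measure.infinitePi_map_curry (fun (i : ι) (_ : κ) => μ i)
    simp only [Measure.infinitePi_eq_pi] at this
    exact this.symm
  rw [hc, Measure.map_map (by fun_prop) (by fun_prop)]
  have hi := (iIndepFun_pi (μ := fun p : ι × κ => μ p.1) (X := fun _ x => x)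
    fun _ => aemeasurable_id).precomp h
  have := (iIndepFun_iff_map_fun_eq_pi_map fun k =>
    (measurable_pi_apply (a k, r k)).aemeasurable).1 hi
  refine Eq.trans this ?_
  congr 1
  funext k
  exact (measurePreserving_eval (fun p : ι × κ => μ p.1) (a k, r k)).map_eq

/-! ### Two-point laws -/

/-- The law with mass `(1 - p) / 2` at `c - s` and mass `(1 + p) / 2` at `c + s`. -/
noncomputable def twoPoint (s c p : ℝ) : Measure ℝ :=
  ENNReal.ofReal ((1 - p) / 2) • Measure.dirac (c - s) +
    ENNReal.ofReal ((1 + p) / 2) • Measure.dirac (c + s)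

lemma isProbabilityMeasure_twoPoint (s c : ℝ) {p : ℝ} (h0 : 0 ≤ p) (h1 : p ≤ 1) :
    IsProbabilityMeasure (twoPoint s c p) := by
  constructor
  simp only [twoPoint, Measure.add_apply, Measure.smul_apply, measure_univ, smul_eq_mul, mul_one]
  rw [← ENNReal.ofReal_add (by linarith) (by linarith)]
  norm_num [← add_div]

lemma integrable_twoPoint (s c p : ℝ) (f : ℝ → ℝ) : Integrable f (twoPoint s c p) := by
  refine Integrable.add_measure ?_ ?_ <;>
  exact (integrable_dirac (by simp)).smul_measure ENNReal.ofReal_ne_top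

lemma integral_twoPoint (s c : ℝ) {p : ℝ} (h0 : 0 ≤ p) (h1 : p ≤ 1) (f : ℝ → ℝ) :
    ∫ x, f x ∂(twoPoint s c p) = (1 - p) / 2 * f (c - s) + (1 + p) / 2 * f (c + s) := by
  have hi (q y : ℝ) : Integrable f (ENNReal.ofReal q • Measure.dirac y) :=
    (integrable_dirac (by simp)).smul_measure ENNReal.ofReal_ne_top
  rw [twoPoint, integral_add_measure (hi _ _) (hi _ _), integral_smul_measure,
    integral_smul_measure, integral_dirac, integral_dirac,
    ENNReal.toReal_ofReal (by linarith), ENNReal.toReal_ofReal (by linarith)]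
  simp

lemma mean_twoPoint (s c : ℝ) {p : ℝ} (h0 : 0 ≤ p) (h1 : p ≤ 1) :
    ∫ x, x ∂(twoPoint s c p) = c + s * p := by
  rw [integral_twoPoint s c h0 h1 fun x => x]
  ring

lemma hasSubgaussianMGF_twoPoint (σ : ℝ≥0) (c : ℝ) {p : ℝ} (h0 : 0 ≤ p) (h1 : p ≤ 1) :
    HasSubgaussianMGF (fun x => x - ∫ y, y ∂(twoPoint σ c p)) (σ ^ 2) (twoPoint σ c p) := by
  have := isProbabilityMeasure_twoPoint σ c h0 h1
  have hs : ∀ᵐ x ∂(twoPoint σ c p), x ∈ Set.Icc (c - σ) (c + σ) := by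
    have : (0 : ℝ) ≤ σ := σ.2
    refine (ae_add_measure_iff.2 ⟨?_, ?_⟩) <;>
    refine Measure.ae_smul_measure ?_ _ <;>
    refine (ae_dirac_iff (p := fun x => x ∈ Set.Icc _ _) measurableSet_Icc).2 ?_ <;>
    constructor <;> linarith
  have h := hasSubgaussianMGF_of_mem_Icc (X := fun x : ℝ => x) aemeasurable_id hs
  convert h using 2
  ext
  simp only [add_sub_sub_cancel, NNReal.coe_div, coe_nnnorm, Real.norm_eq_abs]
  rw [abs_of_nonneg (by positivity)]
  simp

/-- The density of `twoPoint s c p` with respect to `twoPoint s c 0`. -/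
noncomputable def tilt (c p x : ℝ) : ℝ := if c < x then 1 + p else 1 - p

lemma measurable_tilt (c p : ℝ) : Measurable (tilt c p) :=
  Measurable.ite measurableSet_Ioi measurable_const measurable_const

lemma twoPoint_eq_withDensity {s : ℝ} (hs : 0 < s) (c p : ℝ) :
    twoPoint s c p = (twoPoint s c 0).withDensity fun x => ENNReal.ofReal (tilt c p x) := by
  have hm : Measurable fun x => ENNReal.ofReal (tilt c p x) := (measurable_tilt c p).ennreal_ofReal
  ext t ht
  rw [withDensity_apply _ ht, ← lintegral_indicator ht]
  simp only [twoPoint, lintegral_add_measure, lintegral_smul_measure, lintegral_dirac,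
    Measure.add_apply, Measure.smul_apply, Measure.dirac_apply' _ ht, smul_eq_mul]
  have e1 : tilt c p (c - s) = 1 - p := if_neg (by linarith)
  have e2 : tilt c p (c + s) = 1 + p := if_pos (by linarith)
  have hi (x : ℝ) : t.indicator (fun x => ENNReal.ofReal (tilt c p x)) x =
      ENNReal.ofReal (tilt c p x) * t.indicator 1 x := by
    by_cases hx : x ∈ t <;> simp [hx]
  rw [hi, hi, e1, e2, ← mul_assoc, ← mul_assoc, ← ENNReal.ofReal_mul (by norm_num),
    ← ENNReal.ofReal_mul (by norm_num)]
  congr 4 <;> ring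

/-! ### Integration over histories -/

lemma measurable_snoc (t : ℕ) :
    Measurable fun p : History M K t × (Profile M K × Feedback M K) =>
      (Fin.snoc (α := fun _ => Profile M K × Feedback M K) p.1 p.2 : History M K (t + 1)) := by
  refine measurable_pi_lambda _ fun i => ?_
  refine Fin.lastCases ?_ (fun j => ?_) i
  · simpa using measurable_snd
  · simp only [Fin.snoc_castSucc]
    fun_prop

/-- The conditional law of the profile and the feedback of a round, given the past. -/
noncomputable def roundKernel (I : Instance M K σ) (ties : TieRule M K) (π : Policy M K) (t : ℕ) :
    Kernel (History M K t) (Profile M K × Feedback M K) :=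
  (π.act t) ⊗ₖ (Kernel.prodMkLeft (History M K t) (I.feedback ties))

instance (I : Instance M K σ) (ties : TieRule M K) (π : Policy M K) (t : ℕ) :
    IsMarkovKernel (roundKernel I ties π t) := by
  unfold roundKernel; infer_instance

instance isProbabilityMeasure_historyLaw (I : Instance M K σ) (ties : TieRule M K)
    (π : Policy M K) (t : ℕ) : IsProbabilityMeasure (historyLaw I ties π t) := by
  induction t with
  | zero => unfold historyLaw; infer_instance
  | succ t ih =>
    unfold historyLaw
    exact Measure.isProbabilityMeasure_map (measurable_snoc t).aemeasurable

lemma historyLaw_succ (I : Instance M K σ) (ties : TieRule M K) (π : Policy M K) (t : ℕ) :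
    historyLaw I ties π (t + 1) = ((historyLaw I ties π t) ⊗ₘ (roundKernel I ties π t)).map
      fun p => Fin.snoc (α := fun _ => Profile M K × Feedback M K) p.1 p.2 := rfl

lemma lintegral_historyLaw_succ (I : Instance M K σ) (ties : TieRule M K) (π : Policy M K) (t : ℕ)
    {f : History M K (t + 1) → ℝ≥0∞} (hf : Measurable f) :
    ∫⁻ h, f h ∂(historyLaw I ties π (t + 1)) =
      ∫⁻ h, ∫⁻ p, f (Fin.snoc (α := fun _ => Profile M K × Feedback M K) h p)
        ∂(roundKernel I ties π t h) ∂(historyLaw I ties π t) := by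
  rw [historyLaw_succ, lintegral_map hf (measurable_snoc t)]
  exact Measure.lintegral_compProd (hf.comp (measurable_snoc t))

/-- If `ℓ (a, ·)` is at most the density of the feedback under `J` with respect to the feedback
under `I`, then the product of the `ℓ` over the rounds is at most the density of the history under
`J` with respect to the history under `I`: the policy contributes the same factor to both. -/
lemma lintegral_mul_prod_historyLaw_le (I J : Instance M K σ) (ties : TieRule M K)
    (π : Policy M K) {ℓ : Profile M K × Feedback M K → ℝ≥0∞} (hℓ : Measurable ℓ)
    (hle : ∀ a, ∀ f : Feedback M K → ℝ≥0∞, Measurable f →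
      ∫⁻ y, f y * ℓ (a, y) ∂(I.feedback ties a) ≤ ∫⁻ y, f y ∂(J.feedback ties a))
    (t : ℕ) {f : History M K t → ℝ≥0∞} (hf : Measurable f) :
    ∫⁻ h, f h * ∏ i, ℓ (h i) ∂(historyLaw I ties π t) ≤ ∫⁻ h, f h ∂(historyLaw J ties π t) := by
  induction t with
  | zero => simp [historyLaw]
  | succ t ih =>
    have hround (h : History M K t) {g : Profile M K × Feedback M K → ℝ≥0∞} (hg : Measurable g) :
        ∫⁻ p, g p * ℓ p ∂(roundKernel I ties π t h) ≤ ∫⁻ p, g p ∂(roundKernel J ties π t h) := by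
      rw [roundKernel, roundKernel, Kernel.lintegral_compProd _ _ _ (by fun_prop),
        Kernel.lintegral_compProd _ _ _ hg]
      exact lintegral_mono fun a => hle a (fun y => g (a, y)) (hg.comp measurable_prodMk_left)
    have hsnoc (h : History M K t) : Measurable fun p : Profile M K × Feedback M K =>
        f (Fin.snoc (α := fun _ => Profile M K × Feedback M K) h p) :=
      hf.comp ((measurable_snoc t).comp measurable_prodMk_left)
    rw [lintegral_historyLaw_succ _ _ _ _ hf, lintegral_historyLaw_succ _ _ _ _ (by fun_prop)]
    refine le_trans (lintegral_mono fun h => ?_) (ih ?_)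
    · simp only [Fin.prod_univ_castSucc, Fin.snoc_castSucc, Fin.snoc_last]
      simp_rw [mul_comm (∏ i, ℓ (h i)), ← mul_assoc]
      refine (lintegral_mul_const _ ((hsnoc h).mul hℓ)).trans_le ?_
      exact mul_le_mul' (hround h (hsnoc h)) le_rfl
    · exact (hf.comp (measurable_snoc t)).lintegral_kernel_prod_right'

lemma integrable_of_bound {Ω : Type*} [MeasurableSpace Ω] {μ : Measure Ω} [IsFiniteMeasure μ]
    {f : Ω → ℝ} (hf : Measurable f) {C : ℝ} (hC : ∀ x, |f x| ≤ C) : Integrable f μ :=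
  .of_bound hf.aestronglyMeasurable C (.of_forall hC)

/-- A sum over the rounds of terms that are centred given the profile has mean zero. -/
lemma integral_sum_historyLaw_eq_zero (I : Instance M K σ) (ties : TieRule M K)
    (π : Policy M K) {G : Profile M K × Feedback M K → ℝ} (hG : Measurable G) {C : ℝ}
    (hC : ∀ p, |G p| ≤ C) (h0 : ∀ a, ∫ y, G (a, y) ∂(I.feedback ties a) = 0) (t : ℕ) :
    ∫ h, ∑ i, G (h i) ∂(historyLaw I ties π t) = 0 := by
  induction t with
  | zero => simp
  | succ t ih =>
    have hsum (t : ℕ) : Measurable fun h : History M K t => ∑ i, G (h i) := by fun_prop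
    have hbd (t : ℕ) (h : History M K t) : |∑ i, G (h i)| ≤ t * C :=
      (Finset.abs_sum_le_sum_abs _ _).trans
        ((Finset.sum_le_sum fun i _ => hC (h i)).trans (by simp))
    have hround (h : History M K t) : ∫ p, G p ∂(roundKernel I ties π t h) = 0 := by
      rw [roundKernel, integral_compProd (integrable_of_bound hG hC)]
      simp [h0]
    rw [historyLaw_succ, integral_map (measurable_snoc t).aemeasurable
      (hsum _).aestronglyMeasurable]
    refine (Measure.integral_compProd
      (integrable_of_bound ((hsum _).comp (measurable_snoc t)) fun p => hbd _ _)).trans ?_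
    simp only [Function.comp_apply, Fin.sum_univ_castSucc, Fin.snoc_castSucc, Fin.snoc_last]
    rw [← ih]
    refine integral_congr_ae (.of_forall fun h => ?_)
    simp only
    rw [integral_add (integrable_const _) (integrable_of_bound hG hC), hround]
    simp

/-! ### Instances with equal weights, full capacities and no costs -/

/-- Plays on the same arm have distinct ranks, so distinct plays consume distinct entries of the
reward table. -/
lemma injective_arm_rank (w : Fin K → ℝ) (ties : TieRule M K) (a : Profile M K) :
    Function.Injective fun k => (a k, rank w ties a k) := by
  classical
  have hlt {j k : Fin K} (h : Precedes w ties a j k) : rank w ties a j < rank w ties a k := by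
    rw [Fin.lt_def]
    simp only [rank]
    refine Finset.card_lt_card ((Finset.ssubset_iff_of_subset ?_).2 ⟨j, ?_, ?_⟩)
    · intro i hi
      replace hi := (Finset.mem_filter.1 hi).2
      refine Finset.mem_filter.2 ⟨Finset.mem_univ i, hi.1.trans h.1, ?_⟩
      rcases hi.2 with h1 | ⟨h1, h1'⟩ <;> rcases h.2 with h2 | ⟨h2, h2'⟩
      · exact Or.inl (h2.trans h1)
      · exact Or.inl (h2 ▸ h1)
      · exact Or.inl (h1 ▸ h2)
      · exact Or.inr ⟨h1.trans h2, h1'.trans h2'⟩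
    · exact Finset.mem_filter.2 ⟨Finset.mem_univ j, h⟩
    · exact fun hj => by simpa [Precedes] using (Finset.mem_filter.1 hj).2
  intro j k hjk
  obtain ⟨ha, hr⟩ := Prod.mk.inj hjk
  by_contra hne
  have hties : ties a j ≠ ties a k := fun h => hne ((ties a).injective h)
  have : Precedes w ties a j k ∨ Precedes w ties a k j := by
    rcases lt_trichotomy (w j) (w k) with h | h | h
    · exact Or.inr ⟨ha.symm, Or.inl h⟩
    · rcases hties.lt_or_gt with h' | h'
      · exact Or.inl ⟨ha, Or.inr ⟨h, h'⟩⟩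
      · exact Or.inr ⟨ha.symm, Or.inr ⟨h.symm, h'⟩⟩
    · exact Or.inl ⟨ha, Or.inl h⟩
  rcases this with h | h
  · exact (hlt h).ne hr
  · exact (hlt h).ne hr.symm

/-- The instance in which all weights are `α`, all capacities are `K` and all costs are `0`, and
the reward law of arm `m` is `twoPoint σ (c m) (p m)`. -/
noncomputable def twoPointInstance (hK : 0 < K) (σ : ℝ≥0) {α : ℝ} (hα : 0 < α) (c p : Fin M → ℝ)
    (hc : ∀ m, 0 < c m) (h0 : ∀ m, 0 ≤ p m) (h1 : ∀ m, p m ≤ 1) : Instance M K σ where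
  dmax := K
  dmax_pos := hK
  weight _ := α
  weight_pos _ := hα
  weight_antitone := antitone_const
  cost _ _ := 0
  capLaw _ := Measure.dirac K
  capLaw_prob _ := inferInstance
  capLaw_support _ := (ae_dirac_iff (by measurability)).2 ⟨hK, le_rfl⟩
  rewardLaw m := twoPoint σ (c m) (p m)
  rewardLaw_prob m := isProbabilityMeasure_twoPoint σ (c m) (h0 m) (h1 m)
  rewardLaw_subgaussian m := hasSubgaussianMGF_twoPoint σ (c m) (h0 m) (h1 m)
  rewardLaw_mean_pos m := by
    rw [mean_twoPoint _ _ (h0 m) (h1 m)]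
    exact add_pos_of_pos_of_nonneg (hc m) (mul_nonneg σ.2 (h0 m))

open Classical in
/-- The feedback of a round with weights `α` and capacities `K`, if play `k` gets the unit
reward `x k`. -/
noncomputable def flatFeedback (α : ℝ) (a : Profile M K) (x : Fin K → ℝ) : Feedback M K :=
  (fun k => Sum.inl (α * x k), fun m => if ∃ k, a k = m then Sum.inl K else Sum.inr ())

lemma measurable_flatFeedback (α : ℝ) (a : Profile M K) : Measurable (flatFeedback α a) := by
  refine Measurable.prodMk (measurable_pi_lambda _ fun k => ?_) measurable_const
  exact measurable_inl.comp (by fun_prop)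

section

variable (hK : 0 < K) (σ : ℝ≥0) {α : ℝ} (hα : 0 < α) (c p : Fin M → ℝ)
  (hc : ∀ m, 0 < c m) (h0 : ∀ m, 0 ≤ p m) (h1 : ∀ m, p m ≤ 1) (ties : TieRule M K)

lemma mean_twoPointInstance (m : Fin M) :
    (twoPointInstance hK σ hα c p hc h0 h1).mean m = c m + σ * p m :=
  mean_twoPoint _ _ (h0 m) (h1 m)

/-- As no play is ever refused, the feedback is determined by one independent draw per play, and
ranks and ties play no role. -/
lemma feedback_twoPointInstance (a : Profile M K) :
    (twoPointInstance hK σ hα c p hc h0 h1).feedback ties a =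
      (Measure.pi fun k => twoPoint σ (c (a k)) (p (a k))).map (flatFeedback α a) := by
  have hprob (m : Fin M) : IsProbabilityMeasure (twoPoint σ (c m) (p m)) :=
    isProbabilityMeasure_twoPoint σ (c m) (h0 m) (h1 m)
  have hcap : (Measure.pi fun _ : Fin M => Measure.dirac K) = Measure.dirac fun _ => K :=
    Measure.pi_eq fun s hs => by
      classical
      simp only [Measure.dirac_apply, Set.indicator_apply, Pi.one_apply, Set.mem_pi,
        Set.mem_univ, true_imp_iff, Finset.prod_ite_zero, Finset.mem_univ, Finset.prod_const_one]
  change ((Measure.pi fun _ : Fin M => Measure.dirac K).prod (Measure.pi fun m => Measure.pi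
    fun _ : Fin K => twoPoint σ (c m) (p m))).map (observe (fun _ => α) ties a) = _
  rw [← pi_pi_map_of_injective (fun m => twoPoint σ (c m) (p m)) a _
    (injective_arm_rank (fun _ => α) ties a), hcap, Measure.dirac_prod,
    Measure.map_map (measurable_observe _ _ _) (by fun_prop),
    Measure.map_map (measurable_flatFeedback _ _) (by fun_prop)]
  congr 1
  funext R
  have hplay : playReward (fun _ => α) ties a (fun _ => K, R) =
      fun k => Sum.inl (α * R (a k) (rank (fun _ => α) ties a k)) :=
    funext fun k => if_pos (rank (fun _ => α) ties a k).2
  simp [observe, hplay, flatFeedback]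

lemma expectedReward_twoPointInstance (a : Profile M K) (m : Fin M) :
    (twoPointInstance hK σ hα c p hc h0 h1).expectedReward ties a m =
      ∑ k, if a k = m then α * (c (a k) + σ * p (a k)) else 0 := by
  have hprob (m : Fin M) : IsProbabilityMeasure (twoPoint σ (c m) (p m)) :=
    isProbabilityMeasure_twoPoint σ (c m) (h0 m) (h1 m)
  set I := twoPointInstance hK σ hα c p hc h0 h1
  let F : Feedback M K → ℝ := fun y =>
    ∑ k, if a k = m then Sum.elim id (fun _ => 0) (y.1 k) else 0
  have hF : Measurable F := by
    refine Finset.measurable_sum _ fun k _ => ?_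
    split_ifs
    · exact (Measurable.sumElim measurable_id measurable_const).comp (by fun_prop)
    · exact measurable_const
  have hobs : I.expectedReward ties a m = ∫ y, F y ∂(I.feedback ties a) :=
    (integral_map (measurable_observe _ _ _).aemeasurable hF.aestronglyMeasurable).symm
  rw [hobs, feedback_twoPointInstance, integral_map (measurable_flatFeedback _ _).aemeasurable
    hF.aestronglyMeasurable]
  simp only [F, flatFeedback, Sum.elim_inl, id]
  have hint (k : Fin K) : Integrable (fun x : Fin K → ℝ => α * x k)
      (Measure.pi fun k => twoPoint σ (c (a k)) (p (a k))) :=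
    (integrable_comp_eval (μ := fun k => twoPoint σ (c (a k)) (p (a k)))
      (integrable_twoPoint σ _ _ id)).const_mul α
  rw [integral_finsetSum _ fun k _ => by split_ifs; exacts [hint k, integrable_zero _ _ _]]
  refine Finset.sum_congr rfl fun k _ => ?_
  split_ifs
  · rw [integral_const_mul, integral_comp_eval
      (μ := fun k => twoPoint σ (c (a k)) (p (a k))) (f := fun x => x) (i := k)
      aestronglyMeasurable_id, mean_twoPoint _ _ (h0 _) (h1 _)]
  · simp

lemma ereal_coe_sum {ι : Type*} (s : Finset ι) (f : ι → ℝ) :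
    ((∑ i ∈ s, f i : ℝ) : EReal) = ∑ i ∈ s, (f i : EReal) :=
  map_sum (⟨⟨fun x : ℝ => (x : EReal), EReal.coe_zero⟩, EReal.coe_add⟩ : ℝ →+ EReal) f s

lemma utility_twoPointInstance (a : Profile M K) :
    (twoPointInstance hK σ hα c p hc h0 h1).utility ties a =
      ((∑ k, α * (c (a k) + σ * p (a k)) : ℝ) : EReal) := by
  unfold Instance.utility
  simp_rw [expectedReward_twoPointInstance]
  have hcost (m : Fin M) : (∑ k, if a k = m then
      (twoPointInstance hK σ hα c p hc h0 h1).cost k m else 0) = 0 :=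
    Finset.sum_eq_zero fun k _ => ite_self _
  simp_rw [hcost, EReal.coe_ennreal_zero, sub_zero]
  rw [← ereal_coe_sum, Finset.sum_comm]
  simp

/-- The profile that sends all plays to arm `m` bounds the gap from below. -/
lemma le_gap_twoPointInstance (a : Profile M K) (m : Fin M) :
    ENNReal.ofReal (∑ k, α * ((c m + σ * p m) - (c (a k) + σ * p (a k)))) ≤
      (twoPointInstance hK σ hα c p hc h0 h1).gap ties a := by
  have h := le_iSup (fun b => (twoPointInstance hK σ hα c p hc h0 h1).utility ties b) fun _ => m
  refine le_trans ?_ (EReal.toENNReal_le_toENNReal (EReal.sub_le_sub h le_rfl))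
  simp only [utility_twoPointInstance]
  rw [← EReal.coe_sub, EReal.real_coe_toENNReal, ← Finset.sum_sub_distrib]
  simp_rw [mul_sub]
  exact le_rfl

end

/-! ### Counting the plays on an arm -/

/-- The number of plays that the profile `a` sends to arm `m`. -/
def playsOn (a : Profile M K) (m : Fin M) : ℕ := (Finset.univ.filter fun k => a k = m).card

lemma playsOn_le (a : Profile M K) (m : Fin M) : playsOn a m ≤ K :=
  (Finset.card_filter_le _ _).trans (by simp)

lemma sum_playsOn (a : Profile M K) : ∑ m, playsOn a m = K := by
  have := Finset.card_eq_sum_card_fiberwise (f := a) (s := Finset.univ) (t := Finset.univ)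
    fun _ _ => Finset.mem_coe.2 (Finset.mem_univ _)
  simpa [playsOn] using this.symm

/-- The number of plays sent to arm `m` during a history. -/
def totalOn {t : ℕ} (h : History M K t) (m : Fin M) : ℝ := ∑ i, (playsOn (h i).1 m : ℝ)

lemma totalOn_nonneg {t : ℕ} (h : History M K t) (m : Fin M) : 0 ≤ totalOn h m :=
  Finset.sum_nonneg fun _ _ => Nat.cast_nonneg _

lemma totalOn_le {t : ℕ} (h : History M K t) (m : Fin M) : totalOn h m ≤ K * t := by
  refine (Finset.sum_le_sum fun i _ => Nat.cast_le.2 (playsOn_le (h i).1 m)).trans ?_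
  simp [mul_comm]

lemma sum_totalOn {t : ℕ} (h : History M K t) : ∑ m, totalOn h m = K * t := by
  unfold totalOn
  rw [Finset.sum_comm]
  simp_rw [← Nat.cast_sum, sum_playsOn]
  simp [mul_comm]

lemma measurable_totalOn (t : ℕ) (m : Fin M) :
    Measurable fun h : History M K t => totalOn h m := by
  refine Finset.measurable_sum _ fun i _ => ?_
  exact (measurable_of_countable fun a : Profile M K => (playsOn a m : ℝ)).comp (by fun_prop)

lemma integrable_totalOn (t : ℕ) (m : Fin M) (P : Measure (History M K t)) [IsFiniteMeasure P] :
    Integrable (fun h => totalOn h m) P :=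
  integrable_of_bound (measurable_totalOn t m) (C := K * t) fun h => by
    rw [abs_of_nonneg (totalOn_nonneg h m)]; exact totalOn_le h m

/-- Some arm gets at most its share of the plays. -/
lemma exists_integral_totalOn_le (hM : 0 < M) (t : ℕ) (P : Measure (History M K t))
    [IsProbabilityMeasure P] : ∃ m, ∫ h, totalOn h m ∂P ≤ K * t / M := by
  by_contra! hlt
  have hne : (Finset.univ : Finset (Fin M)).Nonempty := ⟨⟨0, hM⟩, Finset.mem_univ _⟩
  have h := Finset.sum_lt_sum_of_nonempty hne fun m _ => hlt m
  rw [← integral_finsetSum _ fun m _ => integrable_totalOn t m P] at h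
  simp_rw [sum_totalOn] at h
  have : (M : ℝ) ≠ 0 := by positivity
  simp only [Finset.sum_const, Finset.card_univ, Fintype.card_fin, nsmul_eq_mul, integral_const,
    probReal_univ, smul_eq_mul, one_mul] at h
  field_simp at h
  exact lt_irrefl _ h

/-! ### From densities to regret -/

lemma prod_le_pow_bound {t : ℕ} {ℓ : Profile M K × Feedback M K → ℝ} (h0 : ∀ q, 0 ≤ ℓ q) {B : ℝ}
    (hB : ∀ q, ℓ q ≤ B) (h : History M K t) : ∏ i, ℓ (h i) ≤ B ^ t :=
  (Finset.prod_le_prod (fun i _ => h0 (h i)) fun i _ => hB (h i)).trans (by simp)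

/-- If every play that is not on arm `m` costs `c` under `J`, then the regret under `J` is
at least `c` times the number of such plays, averaged over the histories under `I` weighted by
their likelihood ratio. -/
lemma le_regret_of_density (I J : Instance M K σ) (ties : TieRule M K) (π : Policy M K) (T : ℕ)
    (m : Fin M) {c : ℝ} (hc : 0 ≤ c)
    (hgap : ∀ a, ENNReal.ofReal (c * (K - playsOn a m)) ≤ J.gap ties a)
    {ℓ : Profile M K × Feedback M K → ℝ} (hℓ : Measurable ℓ) (h0 : ∀ q, 0 ≤ ℓ q) {B : ℝ}
    (hB : ∀ q, ℓ q ≤ B)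
    (hle : ∀ a, ∀ f : Feedback M K → ℝ≥0∞, Measurable f →
      ∫⁻ y, f y * ENNReal.ofReal (ℓ (a, y)) ∂(I.feedback ties a) ≤
        ∫⁻ y, f y ∂(J.feedback ties a)) :
    ENNReal.ofReal (c * ∫ h, (K * T - totalOn h m) * ∏ i, ℓ (h i) ∂(historyLaw I ties π T)) ≤
      regret J ties π T := by
  have hmeas : Measurable fun h : History M K T => c * (K * T - totalOn h m) :=
    ((measurable_totalOn T m).const_sub _).const_mul _
  have hprod : Measurable fun h : History M K T => ∏ i, ℓ (h i) := by fun_prop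
  have hpos (h : History M K T) : 0 ≤ c * (K * T - totalOn h m) :=
    mul_nonneg hc (sub_nonneg.2 (totalOn_le h m))
  have hpp (h : History M K T) : 0 ≤ ∏ i, ℓ (h i) := Finset.prod_nonneg fun i _ => h0 (h i)
  calc ENNReal.ofReal (c * ∫ h, (K * T - totalOn h m) * ∏ i, ℓ (h i) ∂(historyLaw I ties π T))
      = ∫⁻ h, ENNReal.ofReal (c * (K * T - totalOn h m) * ∏ i, ℓ (h i))
          ∂(historyLaw I ties π T) := by
        rw [← integral_const_mul, ← ofReal_integral_eq_lintegral_ofReal]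
        · simp_rw [mul_assoc]
        · refine integrable_of_bound (hmeas.mul hprod) (C := c * (K * T) * B ^ T) fun h => ?_
          rw [abs_of_nonneg (mul_nonneg (hpos h) (hpp h))]
          refine mul_le_mul (mul_le_mul_of_nonneg_left ?_ hc) (prod_le_pow_bound h0 hB h) (hpp h)
            (by positivity)
          linarith [totalOn_nonneg h m]
        · exact .of_forall fun h => mul_nonneg (hpos h) (hpp h)
    _ = ∫⁻ h, ENNReal.ofReal (c * (K * T - totalOn h m)) * ∏ i, ENNReal.ofReal (ℓ (h i))
          ∂(historyLaw I ties π T) := by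
        refine lintegral_congr fun h => ?_
        rw [ENNReal.ofReal_mul (hpos h), ENNReal.ofReal_prod_of_nonneg fun i _ => h0 (h i)]
    _ ≤ ∫⁻ h, ENNReal.ofReal (c * (K * T - totalOn h m)) ∂(historyLaw J ties π T) :=
        lintegral_mul_prod_historyLaw_le I J ties π hℓ.ennreal_ofReal hle T hmeas.ennreal_ofReal
    _ ≤ regret J ties π T := by
        refine lintegral_mono fun h => ?_
        have hsum : c * (K * T - totalOn h m) = ∑ i, c * (K - playsOn (h i).1 m) := by
          rw [← Finset.mul_sum, Finset.sum_sub_distrib, totalOn]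
          simp [mul_comm]
        rw [hsum, ENNReal.ofReal_sum_of_nonneg fun i _ => mul_nonneg hc
          (sub_nonneg.2 (Nat.cast_le.2 (playsOn_le _ _)))]
        exact Finset.sum_le_sum fun i _ => hgap _

/-! ### Two pointwise inequalities -/

lemma log_le_sub_one_sub_sq {x : ℝ} (h0 : 0 < x) (h1 : x ≤ 1) :
    Real.log x ≤ (x - 1) - (x - 1) ^ 2 / 2 := by
  have h := Real.hasSum_pow_div_log_of_abs_lt_one (x := 1 - x)
    (by rw [abs_of_nonneg (by linarith)]; linarith)
  have h2 := sum_le_hasSum (Finset.range 2) (fun i _ => by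
    have : 0 ≤ 1 - x := by linarith
    positivity) h
  norm_num [Finset.sum_range_succ] at h2
  nlinarith

/-- A pointwise form of Pinsker's inequality: under the law with respect to which `L` is a density,
`L - 1 - log L` integrates to a relative entropy. -/
lemma sub_mul_ge {n N L : ℝ} (hN : 0 ≤ N) (hNn : N ≤ n) (hL : 0 < L) :
    n - N - n * (1 / 8 + 4 * (L - 1 - Real.log L)) ≤ (n - N) * L := by
  rcases le_or_gt L 1 with h1 | h1
  · have hlog := log_le_sub_one_sub_sq hL h1
    have : 1 - L ≤ 1 / 8 + 4 * (L - 1 - Real.log L) := by nlinarith [sq_nonneg (1 - L - 1 / 4)]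
    nlinarith
  · have hlog := Real.log_le_sub_one_of_pos hL
    nlinarith [mul_nonneg (hN.trans hNn) (by linarith : 0 ≤ 1 / 8 + 4 * (L - 1 - Real.log L))]

section

variable (hK : 0 < K) (σ : ℝ≥0) {α : ℝ} (hα : 0 < α)

/-- If the mean of arm `m` exceeds all others by `Δ`, then each play that is not on arm `m` costs
`α * Δ`. -/
lemma le_gap_of_lead (c p : Fin M → ℝ) (hc : ∀ m, 0 < c m) (h0 : ∀ m, 0 ≤ p m)
    (h1 : ∀ m, p m ≤ 1) (ties : TieRule M K) (m : Fin M) {Δ : ℝ}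
    (hlead : ∀ j, j ≠ m → (c m + σ * p m) - (c j + σ * p j) = Δ) (a : Profile M K) :
    ENNReal.ofReal (α * Δ * (K - playsOn a m)) ≤
      (twoPointInstance hK σ hα c p hc h0 h1).gap ties a := by
  refine le_trans (le_of_eq ?_) (le_gap_twoPointInstance hK σ hα c p hc h0 h1 ties a m)
  congr 1
  have hterm (k : Fin K) : α * ((c m + σ * p m) - (c (a k) + σ * p (a k))) =
      α * Δ * (1 - if a k = m then 1 else 0) := by
    split_ifs with h
    · simp [h]
    · rw [hlead _ h]; simp
  simp_rw [hterm]
  rw [← Finset.mul_sum, Finset.sum_sub_distrib]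
  simp [playsOn]

/-- The instance in which all reward laws are `twoPoint σ c 0`. -/
noncomputable def equalInstance {c : ℝ} (hc : 0 < c) : Instance M K σ :=
  twoPointInstance hK σ hα (fun _ => c) (fun _ => 0) (fun _ => hc) (fun _ => le_rfl)
    fun _ => zero_le_one

/-! ### Too few rounds to try all arms -/

/-- If arm `m` gets at most `K * T / M` plays on average when all arms are equal, it is missed
altogether with probability at least `1 - K * T / M`, whatever its lead `Δ`. -/
lemma exists_instance_of_few_plays (hM : 0 < M) (ties : TieRule M K) {T : ℕ} (π : Policy M K)
    {Δ : ℝ} (hΔ : 0 ≤ Δ) :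
    ∃ (c p : Fin M → ℝ) (hc : ∀ m, 0 < c m) (h0 : ∀ m, 0 ≤ p m) (h1 : ∀ m, p m ≤ 1),
      ENNReal.ofReal (α * Δ * (K * T * (1 - K * T / M))) ≤
        regret (twoPointInstance hK σ hα c p hc h0 h1) ties π T := by
  let I : Instance M K σ := equalInstance hK σ hα one_pos
  obtain ⟨m, hm⟩ := exists_integral_totalOn_le hM T (historyLaw I ties π T)
  have hc : ∀ j, 0 < (fun j => if j = m then 1 + Δ else 1 : Fin M → ℝ) j := fun j => by
    dsimp only; split_ifs <;> linarith
  refine ⟨_, fun _ => 0, hc, fun _ => le_rfl, fun _ => zero_le_one, ?_⟩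
  set J : Instance M K σ := twoPointInstance hK σ hα _ (fun _ => 0) hc (fun _ => le_rfl)
    fun _ => zero_le_one
  -- the two instances cannot be told apart until a play is sent to arm `m`
  let ℓ : Profile M K × Feedback M K → ℝ := fun q => if playsOn q.1 m = 0 then 1 else 0
  have hℓ0 (q) : 0 ≤ ℓ q := by dsimp only [ℓ]; split_ifs <;> norm_num
  have hℓ1 (q) : ℓ q ≤ 1 := by dsimp only [ℓ]; split_ifs <;> norm_num
  have hℓ : Measurable ℓ :=
    (measurable_of_countable fun a : Profile M K => if playsOn a m = 0 then (1 : ℝ) else 0).comp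
      measurable_fst
  have hgap := le_gap_of_lead hK σ hα _ (fun _ => 0) hc (fun _ => le_rfl)
    (fun _ => zero_le_one) ties m (Δ := Δ) fun j hj => by simp [hj]
  refine le_trans ?_ (le_regret_of_density I J ties π T m (by positivity) hgap hℓ hℓ0 hℓ1
    fun a f hf => ?_)
  · refine ENNReal.ofReal_le_ofReal (mul_le_mul_of_nonneg_left ?_ (by positivity))
    have hint := integrable_totalOn T m (historyLaw I ties π T)
    have hprod : Measurable fun h : History M K T => ∏ i, ℓ (h i) := by fun_prop
    calc (K * T * (1 - K * T / M) : ℝ)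
        ≤ K * T * (1 - ∫ h, totalOn h m ∂(historyLaw I ties π T)) := by gcongr
      _ = ∫ h, (K * T * (1 - totalOn h m) : ℝ) ∂(historyLaw I ties π T) := by
        rw [integral_const_mul, integral_sub (integrable_const _) hint]
        simp
      _ ≤ _ := by
        refine integral_mono (((integrable_const _).sub hint).const_mul _)
          (integrable_of_bound (((measurable_totalOn T m).const_sub _).mul hprod)
            (C := K * T * 1 ^ T) fun h => ?_) fun h => ?_
        · have hpp : 0 ≤ ∏ i, ℓ (h i) := Finset.prod_nonneg fun i _ => hℓ0 (h i)
          have := totalOn_le h m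
          rw [abs_of_nonneg (mul_nonneg (by linarith) hpp)]
          exact mul_le_mul (by linarith [totalOn_nonneg h m]) (prod_le_pow_bound hℓ0 hℓ1 h) hpp
            (by positivity)
        · dsimp only
          have hle := totalOn_le h m
          by_cases hz : ∀ i, playsOn (h i).1 m = 0
          · have h1 : totalOn h m = 0 := Finset.sum_eq_zero fun i _ => by simp [hz i]
            have h2 : ∏ i, ℓ (h i) = 1 := Finset.prod_eq_one fun i _ => if_pos (hz i)
            rw [h1, h2]; simp
          · push Not at hz
            obtain ⟨i, hi⟩ := hz
            have h1 : (1 : ℝ) ≤ totalOn h m := by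
              refine le_trans ?_ (Finset.single_le_sum (f := fun i => (playsOn (h i).1 m : ℝ))
                (fun _ _ => Nat.cast_nonneg _) (Finset.mem_univ i))
              exact_mod_cast Nat.one_le_iff_ne_zero.2 hi
            have h2 : 0 ≤ ∏ i, ℓ (h i) := Finset.prod_nonneg fun i _ => hℓ0 (h i)
            have h3 : (0 : ℝ) ≤ K * T := by positivity
            nlinarith [mul_nonneg (sub_nonneg.2 hle) h2, mul_nonneg h3 (sub_nonneg.2 h1)]
  · by_cases hz : playsOn a m = 0
    · have hne (k : Fin K) : a k ≠ m := by
        have := Finset.card_eq_zero.1 hz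
        exact fun h => Finset.notMem_empty k (this ▸ Finset.mem_filter.2 ⟨Finset.mem_univ k, h⟩)
      have hIJ : I.feedback ties a = J.feedback ties a := by
        simp only [I, J, equalInstance, feedback_twoPointInstance, hne, if_false]
      simp [ℓ, hz, hIJ]
    · simp [ℓ, hz]

/-! ### Enough rounds to try all arms -/

/-- The likelihood ratio of the feedback of a round for a tilt by `p` of the reward law of
arm `m`, as a product over the plays. -/
noncomputable def likelihood (α c p : ℝ) (m : Fin M) (q : Profile M K × Feedback M K) : ℝ :=
  ∏ k, if q.1 k = m then Sum.elim (tilt (α * c) p) (fun _ => 1) (q.2.1 k) else 1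

lemma tilt_mul {α : ℝ} (hα : 0 < α) (c p x : ℝ) : tilt (α * c) p (α * x) = tilt c p x := by
  simp [tilt, hα]

lemma measurable_likelihood (α c p : ℝ) (m : Fin M) :
    Measurable (likelihood (K := K) α c p m) := by
  refine measurable_from_prod_countable_right fun a => ?_
  refine Finset.measurable_prod _ fun k _ => ?_
  dsimp only
  split_ifs
  · exact (Measurable.sumElim (measurable_tilt _ _) measurable_const).comp (by fun_prop)
  · exact measurable_const

lemma likelihood_factor_mem {p : ℝ} (h0 : 0 ≤ p) (α c : ℝ) (m : Fin M)
    (q : Profile M K × Feedback M K) (k : Fin K) :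
    (if q.1 k = m then Sum.elim (tilt (α * c) p) (fun _ => 1) (q.2.1 k) else 1) ∈
      Set.Icc (1 - p) (1 + p) := by
  constructor <;> split_ifs <;> try linarith
  all_goals
    rcases q.2.1 k with x | x
    · simp only [Sum.elim_inl, tilt]; split_ifs <;> linarith
    · simp only [Sum.elim_inr]; linarith

lemma likelihood_pos {p : ℝ} (h0 : 0 ≤ p) (h1 : p < 1) (α c : ℝ) (m : Fin M)
    (q : Profile M K × Feedback M K) : 0 < likelihood α c p m q :=
  Finset.prod_pos fun k _ => (sub_pos.2 h1).trans_le (likelihood_factor_mem h0 α c m q k).1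

lemma likelihood_le {p : ℝ} (h0 : 0 ≤ p) (h1 : p < 1) (α c : ℝ) (m : Fin M)
    (q : Profile M K × Feedback M K) : likelihood α c p m q ≤ (1 + p) ^ K := by
  refine (Finset.prod_le_prod (fun k _ => ?_) fun k _ =>
    (likelihood_factor_mem h0 α c m q k).2).trans (by simp)
  exact (sub_pos.2 h1).le.trans (likelihood_factor_mem h0 α c m q k).1

lemma le_likelihood {p : ℝ} (h0 : 0 ≤ p) (h1 : p < 1) (α c : ℝ) (m : Fin M)
    (q : Profile M K × Feedback M K) : (1 - p) ^ K ≤ likelihood α c p m q := by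
  refine le_trans (by simp) (Finset.prod_le_prod (fun k _ => (sub_pos.2 h1).le) fun k _ =>
    (likelihood_factor_mem h0 α c m q k).1)

lemma abs_log_likelihood_le {p : ℝ} (h0 : 0 ≤ p) (h1 : p < 1) (α c : ℝ) (m : Fin M)
    (q : Profile M K × Feedback M K) :
    |Real.log (likelihood α c p m q)| ≤
      |Real.log ((1 - p) ^ K)| + |Real.log ((1 + p) ^ K)| := by
  have hl := Real.log_le_log (pow_pos (sub_pos.2 h1) K) (le_likelihood h0 h1 α c m q)
  have hu := Real.log_le_log (likelihood_pos h0 h1 α c m q) (likelihood_le h0 h1 α c m q)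
  rw [abs_le]
  constructor
  · linarith [neg_abs_le (Real.log ((1 - p) ^ K)), abs_nonneg (Real.log ((1 + p) ^ K))]
  · linarith [le_abs_self (Real.log ((1 + p) ^ K)), abs_nonneg (Real.log ((1 - p) ^ K))]

lemma likelihood_flatFeedback {α : ℝ} (hα : 0 < α) (c p : ℝ) (m : Fin M) (a : Profile M K)
    (x : Fin K → ℝ) : likelihood α c p m (a, flatFeedback α a x) =
      ∏ k, if a k = m then tilt c p (x k) else 1 := by
  simp [likelihood, flatFeedback, tilt_mul hα]

/-- The instance in which all reward laws are centred at `c` and the law of arm `m` is tilted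
by `p`. -/
noncomputable def tiltedInstance {c p : ℝ} (hc : 0 < c) (h0 : 0 ≤ p) (h1 : p < 1) (m : Fin M) :
    Instance M K σ :=
  twoPointInstance hK σ hα (fun _ => c) (fun j => if j = m then p else 0) (fun _ => hc)
    (fun j => by split_ifs <;> simp [h0]) (fun j => by split_ifs <;> simp [h1.le])

variable {c p : ℝ} (hc : 0 < c) (ties : TieRule M K)

lemma lintegral_feedback_mul_likelihood (hσ : 0 < σ) (h0 : 0 ≤ p) (h1 : p < 1) (m : Fin M) (a : Profile M K)
    {f : Feedback M K → ℝ≥0∞} (hf : Measurable f) :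
    ∫⁻ y, f y * ENNReal.ofReal (likelihood α c p m (a, y))
        ∂((equalInstance hK σ hα hc).feedback ties a) =
      ∫⁻ y, f y ∂((tiltedInstance hK σ hα hc h0 h1 m).feedback ties a) := by
  have hp (j : Fin M) : 0 ≤ (if j = m then p else 0) ∧ (if j = m then p else 0) ≤ 1 := by
    split_ifs <;> simp [h0, h1.le]
  let g : Fin K → ℝ → ℝ≥0∞ := fun k x => ENNReal.ofReal (if a k = m then tilt c p x else 1)
  have hg (k) : Measurable (g k) := by
    dsimp only [g]
    split_ifs
    · exact (measurable_tilt c p).ennreal_ofReal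
    · exact measurable_const
  have hlaw (k : Fin K) : twoPoint σ c (if a k = m then p else 0) =
      (twoPoint σ c 0).withDensity (g k) := by
    dsimp only [g]
    split_ifs
    · exact twoPoint_eq_withDensity (NNReal.coe_pos.2 hσ) c p
    · simp
  have hprob0 : IsProbabilityMeasure (twoPoint σ c 0) :=
    isProbabilityMeasure_twoPoint σ c le_rfl zero_le_one
  have hprob (k) : IsProbabilityMeasure ((twoPoint σ c 0).withDensity (g k)) := by
    rw [← hlaw]
    exact isProbabilityMeasure_twoPoint σ c (hp _).1 (hp _).2
  have hm : Measurable fun y => ENNReal.ofReal (likelihood α c p m (a, y)) :=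
    ((measurable_likelihood α c p m).comp measurable_prodMk_left).ennreal_ofReal
  have hgp : Measurable fun x : Fin K → ℝ => ∏ k, g k (x k) :=
    Finset.measurable_prod _ fun k _ => (hg k).comp (measurable_pi_apply k)
  have hfl := measurable_flatFeedback (M := M) (K := K) α a
  have h1p (y : ℝ) (k : Fin K) : 0 ≤ if a k = m then tilt c p y else 1 := by
    unfold tilt; split_ifs <;> linarith
  rw [equalInstance, tiltedInstance, feedback_twoPointInstance, feedback_twoPointInstance,
    lintegral_map (by fun_prop) hfl, lintegral_map hf hfl]
  simp_rw [hlaw]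
  rw [pi_withDensity _ hg, lintegral_withDensity_eq_lintegral_mul _ hgp
    (show Measurable fun x => f (flatFeedback α a x) from hf.comp hfl)]
  refine lintegral_congr fun x => ?_
  simp only [Pi.mul_apply, likelihood_flatFeedback hα]
  rw [mul_comm, ENNReal.ofReal_prod_of_nonneg fun k _ => h1p (x k) k]

/-- Each play on arm `m` contributes minus the relative entropy of `twoPoint σ c 0` with respect to
`twoPoint σ c p`. -/
lemma integral_log_likelihood (hσ : 0 < σ) (h0 : 0 ≤ p) (h1 : p < 1) (m : Fin M) (a : Profile M K) :
    ∫ y, Real.log (likelihood α c p m (a, y))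
        ∂((equalInstance hK σ hα hc).feedback ties a) =
      playsOn a m * ((Real.log (1 - p) + Real.log (1 + p)) / 2) := by
  have hprob0 : IsProbabilityMeasure (twoPoint σ c 0) :=
    isProbabilityMeasure_twoPoint σ c le_rfl zero_le_one
  have hσ' : (0 : ℝ) < σ := NNReal.coe_pos.2 hσ
  have hm : Measurable fun y => Real.log (likelihood α c p m (a, y)) :=
    ((measurable_likelihood α c p m).comp measurable_prodMk_left).log
  rw [equalInstance, feedback_twoPointInstance,
    integral_map (measurable_flatFeedback _ _).aemeasurable hm.aestronglyMeasurable]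
  simp_rw [likelihood_flatFeedback hα]
  have hlog (x : Fin K → ℝ) : Real.log (∏ k, if a k = m then tilt c p (x k) else 1) =
      ∑ k, if a k = m then Real.log (tilt c p (x k)) else 0 := by
    rw [Real.log_prod fun k _ => ?_]
    · exact Finset.sum_congr rfl fun k _ => by split_ifs <;> simp
    · unfold tilt; split_ifs <;> linarith
  simp_rw [hlog]
  have hint (k : Fin K) : Integrable (fun x : Fin K → ℝ => Real.log (tilt c p (x k)))
      (Measure.pi fun _ => twoPoint σ c 0) :=
    integrable_comp_eval (μ := fun _ => twoPoint σ c 0)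
      (integrable_twoPoint σ c 0 fun x => Real.log (tilt c p x))
  have hone (k : Fin K) : ∫ x : Fin K → ℝ, Real.log (tilt c p (x k))
      ∂(Measure.pi fun _ => twoPoint σ c 0) = (Real.log (1 - p) + Real.log (1 + p)) / 2 := by
    rw [integral_comp_eval (μ := fun _ => twoPoint σ c 0) (i := k)
      (f := fun x => Real.log (tilt c p x)) (measurable_tilt c p).log.aestronglyMeasurable,
      integral_twoPoint _ _ le_rfl zero_le_one]
    have e1 : tilt c p (c - σ) = 1 - p := if_neg (by linarith)
    have e2 : tilt c p (c + σ) = 1 + p := if_pos (by linarith)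
    rw [e1, e2]; ring
  rw [integral_finsetSum _ fun k _ => by split_ifs; exacts [hint k, integrable_zero _ _ _]]
  have hterm (k : Fin K) : ∫ x : Fin K → ℝ, (if a k = m then Real.log (tilt c p (x k)) else 0)
      ∂(Measure.pi fun _ => twoPoint σ c 0) =
      (if a k = m then 1 else 0) * ((Real.log (1 - p) + Real.log (1 + p)) / 2) := by
    split_ifs
    · rw [hone, one_mul]
    · simp
  simp_rw [hterm]
  rw [← Finset.sum_mul]
  simp [playsOn]

end

section

variable (hK : 0 < K) (σ : ℝ≥0) {α : ℝ} (hα : 0 < α) {c p : ℝ} (hc : 0 < c)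
  (ties : TieRule M K) (π : Policy M K) (T : ℕ) (m : Fin M)

/-! ### The regret under a tilt -/

/-- The likelihood ratio of the histories has mean at most `1`. -/
lemma integral_prod_likelihood_le (hσ : 0 < σ) (h0 : 0 ≤ p) (h1 : p < 1) :
    ∫ h, ∏ i, likelihood α c p m (h i) ∂(historyLaw (equalInstance hK σ hα hc) ties π T) ≤ 1 := by
  have hmeas := measurable_likelihood (M := M) (K := K) α c p m
  have hpos (q : Profile M K × Feedback M K) := (likelihood_pos h0 h1 α c m q).le
  have h := lintegral_mul_prod_historyLaw_le (equalInstance hK σ hα hc)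
    (tiltedInstance hK σ hα hc h0 h1 m) ties π hmeas.ennreal_ofReal
    (fun a f hf => (lintegral_feedback_mul_likelihood hK σ hα hc ties hσ h0 h1 m a hf).le) T
    (f := fun _ => 1) measurable_const
  simp only [one_mul, lintegral_const, measure_univ] at h
  simp_rw [← ENNReal.ofReal_prod_of_nonneg fun i _ => hpos _] at h
  rw [← ofReal_integral_eq_lintegral_ofReal] at h
  · simpa using h
  · refine integrable_of_bound (Finset.measurable_prod _ fun i _ => by fun_prop)
      (C := ((1 + p) ^ K) ^ T) fun h => ?_
    rw [abs_of_nonneg (Finset.prod_nonneg fun i _ => hpos _)]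
    exact prod_le_pow_bound hpos (likelihood_le h0 h1 α c m) h
  · exact .of_forall fun h => Finset.prod_nonneg fun i _ => hpos _

lemma abs_sum_log_likelihood_le (h0 : 0 ≤ p) (h1 : p < 1) {t : ℕ} (h : History M K t) :
    |∑ i, Real.log (likelihood α c p m (h i))| ≤
      t * (|Real.log ((1 - p) ^ K)| + |Real.log ((1 + p) ^ K)|) :=
  (Finset.abs_sum_le_sum_abs _ _).trans ((Finset.sum_le_sum fun i _ =>
    abs_log_likelihood_le h0 h1 α c m (h i)).trans
      (by rw [Finset.sum_const, Finset.card_univ, Fintype.card_fin, nsmul_eq_mul]))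

lemma integrable_sum_log_likelihood (h0 : 0 ≤ p) (h1 : p < 1) (P : Measure (History M K T))
    [IsFiniteMeasure P] :
    Integrable (fun h => ∑ i, Real.log (likelihood α c p m (h i))) P := by
  have hmeas := measurable_likelihood (M := M) (K := K) α c p m
  exact integrable_of_bound (Finset.measurable_sum _ fun i _ => by fun_prop)
    (abs_sum_log_likelihood_le m h0 h1)

/-- The chain rule for the relative entropy of the histories (with a minus sign). -/
lemma integral_sum_log_likelihood (hσ : 0 < σ) (h0 : 0 ≤ p) (h1 : p < 1) :
    ∫ h, ∑ i, Real.log (likelihood α c p m (h i))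
        ∂(historyLaw (equalInstance hK σ hα hc) ties π T) =
      (Real.log (1 - p) + Real.log (1 + p)) / 2 *
        ∫ h, totalOn h m ∂(historyLaw (equalInstance hK σ hα hc) ties π T) := by
  set D := (Real.log (1 - p) + Real.log (1 + p)) / 2
  have hmeas := measurable_likelihood (M := M) (K := K) α c p m
  have hplays : Measurable fun q : Profile M K × Feedback M K => (playsOn q.1 m : ℝ) :=
    (measurable_of_countable fun a : Profile M K => (playsOn a m : ℝ)).comp measurable_fst
  have hcentred := integral_sum_historyLaw_eq_zero (equalInstance hK σ hα hc) ties π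
    (G := fun q => Real.log (likelihood α c p m q) - playsOn q.1 m * D)
    (hmeas.log.sub (hplays.mul_const D))
    (C := |Real.log ((1 - p) ^ K)| + |Real.log ((1 + p) ^ K)| + K * |D|)
    (fun q => (abs_sub _ _).trans (add_le_add (abs_log_likelihood_le h0 h1 α c m q) (by
      rw [abs_mul, Nat.abs_cast]
      exact mul_le_mul_of_nonneg_right (Nat.cast_le.2 (playsOn_le q.1 m)) (abs_nonneg D))))
    (fun a => by
      have hint : Integrable (fun y => Real.log (likelihood α c p m (a, y)))
          ((equalInstance hK σ hα hc).feedback ties a) :=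
        integrable_of_bound (hmeas.log.comp measurable_prodMk_left)
          fun y => abs_log_likelihood_le h0 h1 α c m (a, y)
      refine (integral_sub hint (integrable_const (playsOn a m * D))).trans ?_
      rw [integral_log_likelihood hK σ hα hc ties hσ h0 h1]
      simp [D]) T
  have hsplit (h : History M K T) :
      ∑ i, (Real.log (likelihood α c p m (h i)) - playsOn (h i).1 m * D) =
        (∑ i, Real.log (likelihood α c p m (h i))) - D * totalOn h m := by
    rw [Finset.sum_sub_distrib, ← Finset.sum_mul, mul_comm D, totalOn]
  simp_rw [hsplit] at hcentred
  rw [integral_sub (integrable_sum_log_likelihood T m h0 h1 _)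
    ((integrable_totalOn T m _).const_mul D), integral_const_mul] at hcentred
  linarith

lemma neg_sq_le_half_log_add_log {p : ℝ} (h0 : 0 ≤ p) (hp : p ^ 2 ≤ 1 / 2) :
    -p ^ 2 ≤ (Real.log (1 - p) + Real.log (1 + p)) / 2 := by
  have hlt : p < 1 := by nlinarith
  have hpos : 0 < 1 - p ^ 2 := by linarith
  rw [← Real.log_mul (by linarith) (by linarith), show (1 - p) * (1 + p) = 1 - p ^ 2 by ring]
  have h := Real.one_sub_inv_le_log_of_pos hpos
  have hinv : (1 - p ^ 2)⁻¹ ≤ 1 + 2 * p ^ 2 := by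
    rw [inv_le_iff_one_le_mul₀ hpos]
    nlinarith [sq_nonneg p]
  linarith

/-- The lower bound for an arm `m` that gets few plays when all arms are equal: tilted by `p`, it
still gets few plays. -/
lemma le_regret_tiltedInstance (hσ : 0 < σ) (h0 : 0 ≤ p) (h1 : p < 1) (hp : p ^ 2 ≤ 1 / 2) :
    ENNReal.ofReal (α * (σ * p) * (K * T * (7 / 8) -
      (1 + 4 * (K * T) * p ^ 2) *
        ∫ h, totalOn h m ∂(historyLaw (equalInstance hK σ hα hc) ties π T))) ≤
      regret (tiltedInstance hK σ hα hc h0 h1 m) ties π T := by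
  have hmeas := measurable_likelihood (M := M) (K := K) α c p m
  have hpos (q : Profile M K × Feedback M K) := likelihood_pos h0 h1 α c m q
  have hprod : Measurable fun h : History M K T => ∏ i, likelihood α c p m (h i) := by fun_prop
  have hprodpos (h : History M K T) : 0 < ∏ i, likelihood α c p m (h i) :=
    Finset.prod_pos fun i _ => hpos _
  have hprodle (h : History M K T) :=
    prod_le_pow_bound (fun q => (hpos q).le) (likelihood_le h0 h1 α c m) h
  have hgap (a : Profile M K) : ENNReal.ofReal (α * (σ * p) * (K - playsOn a m)) ≤
      (tiltedInstance hK σ hα hc h0 h1 m).gap ties a :=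
    le_gap_of_lead hK σ hα _ _ _ _ _ ties m (fun j hj => by simp [hj]) a
  refine le_trans ?_ (le_regret_of_density (equalInstance hK σ hα hc)
    (tiltedInstance hK σ hα hc h0 h1 m) ties π T m (by positivity) hgap hmeas
    (fun q => (hpos q).le) (likelihood_le h0 h1 α c m) fun a f hf =>
      (lintegral_feedback_mul_likelihood hK σ hα hc ties hσ h0 h1 m a hf).le)
  refine ENNReal.ofReal_le_ofReal (mul_le_mul_of_nonneg_left ?_ (by positivity))
  have hint := integrable_totalOn T m (historyLaw (equalInstance hK σ hα hc) ties π T)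
  have hL : Integrable (fun h : History M K T => ∏ i, likelihood α c p m (h i))
      (historyLaw (equalInstance hK σ hα hc) ties π T) :=
    integrable_of_bound hprod (C := ((1 + p) ^ K) ^ T) fun h => by
      rw [abs_of_pos (hprodpos h)]; exact hprodle h
  have hlog := integrable_sum_log_likelihood (α := α) (c := c) T m h0 h1
    (historyLaw (equalInstance hK σ hα hc) ties π T)
  have hL1 := integral_prod_likelihood_le hK σ hα hc ties π T m hσ h0 h1
  have hlogE := integral_sum_log_likelihood hK σ hα hc ties π T m hσ h0 h1
  have hD := neg_sq_le_half_log_add_log h0 hp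
  have hN : 0 ≤ ∫ h, totalOn h m ∂(historyLaw (equalInstance hK σ hα hc) ties π T) :=
    integral_nonneg fun h => totalOn_nonneg h m
  have hL' : Integrable (fun h : History M K T => ∏ i, likelihood α c p m (h i) - 1)
      (historyLaw (equalInstance hK σ hα hc) ties π T) := hL.sub (integrable_const 1)
  have hrest : Integrable (fun h : History M K T => ∏ i, likelihood α c p m (h i) - 1 -
      ∑ i, Real.log (likelihood α c p m (h i)))
      (historyLaw (equalInstance hK σ hα hc) ties π T) := hL'.sub hlog
  have hrest' : Integrable (fun h : History M K T => (K * T : ℝ) * (1 / 8 + 4 *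
      (∏ i, likelihood α c p m (h i) - 1 - ∑ i, Real.log (likelihood α c p m (h i)))))
      (historyLaw (equalInstance hK σ hα hc) ties π T) :=
    ((integrable_const _).add (hrest.const_mul 4)).const_mul _
  have hplays : Integrable (fun h : History M K T => (K * T : ℝ) - totalOn h m)
      (historyLaw (equalInstance hK σ hα hc) ties π T) := (integrable_const _).sub hint
  have hmain : ∫ h, (((K * T : ℝ) - totalOn h m) - K * T * (1 / 8 + 4 *
        (∏ i, likelihood α c p m (h i) - 1 - ∑ i, Real.log (likelihood α c p m (h i)))))
        ∂(historyLaw (equalInstance hK σ hα hc) ties π T) ≤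
      ∫ h, (K * T - totalOn h m) * ∏ i, likelihood α c p m (h i)
        ∂(historyLaw (equalInstance hK σ hα hc) ties π T) := by
    refine integral_mono (hplays.sub hrest')
      (integrable_of_bound (((measurable_totalOn T m).const_sub _).mul hprod)
        (C := K * T * ((1 + p) ^ K) ^ T) fun h => ?_) fun h => ?_
    · have := totalOn_le h m
      rw [abs_of_nonneg (mul_nonneg (by linarith) (hprodpos h).le)]
      exact mul_le_mul (by linarith [totalOn_nonneg h m]) (hprodle h) (hprodpos h).le
        (by positivity)
    · dsimp only
      rw [← Real.log_prod fun i _ => (hpos _).ne']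
      exact sub_mul_ge (totalOn_nonneg h m) (totalOn_le h m) (hprodpos h)
  refine le_trans ?_ hmain
  rw [integral_sub hplays hrest', integral_sub (integrable_const _) hint,
    integral_const_mul (K * T : ℝ) fun h : History M K T => (1 / 8 + 4 *
      (∏ i, likelihood α c p m (h i) - 1 - ∑ i, Real.log (likelihood α c p m (h i))) : ℝ),
    integral_add (integrable_const _) (hrest.const_mul 4), integral_const_mul (4 : ℝ),
    integral_sub hL' hlog, integral_sub hL (integrable_const 1), hlogE]
  simp only [integral_const, probReal_univ, smul_eq_mul, one_mul]
  have hn : (0 : ℝ) ≤ K * T := by positivity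
  nlinarith [mul_le_mul_of_nonneg_left hL1 hn,
    mul_le_mul_of_nonneg_left (mul_le_mul_of_nonneg_right hD hN) hn]

end

end MSB

theorem theorem1 (M K T : ℕ) (hM : 2 ≤ M) (hK : 1 ≤ K) (hT : 1 ≤ T) (σ : ℝ≥0)
    (α₁ : ℝ) (hα₁ : 0 < α₁) (ties : MSB.TieRule M K) (A : MSB.Algorithm M K) :
    ∃ I : MSB.Instance M K σ,
      I.weight ⟨0, hK⟩ = α₁ ∧
      (0 < σ → M ≤ K * T + 1 → ∀ m, I.mean m ≤ σ) ∧
      ENNReal.ofReal (1 / 27 * α₁ * σ * √((M : ℝ) * K * T))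
        ≤ MSB.regret I ties (A I.toPublicData) T := by
  have hM0 : 0 < M := by omega
  have hMr : (2 : ℝ) ≤ M := by exact_mod_cast hM
  have hKT : 1 ≤ K * T := Nat.mul_pos hK hT
  have hn : (1 : ℝ) ≤ K * T := by exact_mod_cast hKT
  -- all instances below have the same public data, so the algorithm plays one policy on them
  set π : MSB.Policy M K := A (MSB.equalInstance hK σ hα₁ one_pos).toPublicData
  rcases eq_or_lt_of_le (zero_le (a := σ)) with hσ | hσ
  · refine ⟨MSB.equalInstance hK σ hα₁ one_pos, rfl, fun h => absurd hσ h.ne, ?_⟩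
    simp [← hσ]
  have hσr : (0 : ℝ) < σ := NNReal.coe_pos.2 hσ
  rcases le_or_gt M (K * T + 1) with hMn | hMn
  · have hMn' : (M : ℝ) ≤ K * T + 1 := by exact_mod_cast hMn
    -- the tilt balances the lead `σ * p` against the number of plays needed to detect it
    set p : ℝ := √(M / (K * T)) / 5 with hp
    have h0 : 0 ≤ p := by positivity
    have hsq : p ^ 2 = M / (K * T) / 25 := by
      rw [hp, div_pow, Real.sq_sqrt (by positivity)]; norm_num
    have hratio : (M : ℝ) / (K * T) ≤ 2 := by
      rw [div_le_iff₀ (by positivity)]; linarith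
    have hp2 : p ^ 2 ≤ 2 / 25 := by rw [hsq]; linarith
    have hphalf : p ≤ 1 / 2 := by nlinarith
    have h1 : p < 1 := by linarith
    have hc : (0 : ℝ) < σ / 2 := by positivity
    obtain ⟨m, hm⟩ := MSB.exists_integral_totalOn_le hM0 T
      (MSB.historyLaw (MSB.equalInstance hK σ hα₁ hc) ties π T)
    refine ⟨MSB.tiltedInstance hK σ hα₁ hc h0 h1 m, rfl, fun _ _ j => ?_, ?_⟩
    · rw [MSB.tiltedInstance, MSB.mean_twoPointInstance]
      split_ifs <;> nlinarith
    · refine le_trans (ENNReal.ofReal_le_ofReal ?_)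
        (MSB.le_regret_tiltedInstance hK σ hα₁ hc ties π T m hσ h0 h1 (by linarith))
      set E := ∫ h, MSB.totalOn h m ∂(MSB.historyLaw (MSB.equalInstance hK σ hα₁ hc) ties π T)
      have hfac : 4 * (K * T) * p ^ 2 = 4 * M / 25 := by
        rw [hsq]; field_simp
      have hE : (1 + 4 * (K * T) * p ^ 2) * E ≤ K * T * (1 / 2 + 4 / 25) := by
        rw [hfac]
        calc (1 + 4 * M / 25) * E ≤ (1 + 4 * M / 25) * (K * T / M) := by gcongr
          _ = K * T * (1 / M + 4 / 25) := by field_simp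
          _ ≤ K * T * (1 / 2 + 4 / 25) := by gcongr
      have hroot : √((M : ℝ) * K * T) = 5 * p * (K * T) := by
        have h : (M : ℝ) * K * T = (5 * p * (K * T)) ^ 2 := by
          rw [mul_pow, mul_pow, hsq]; field_simp; norm_num
        rw [h, Real.sqrt_sq (by positivity)]
      rw [hroot]
      have hpos : 0 ≤ α₁ * (σ * p) := by positivity
      calc 1 / 27 * α₁ * σ * (5 * p * (K * T)) = α₁ * (σ * p) * (K * T * (5 / 27)) := by ring
        _ ≤ _ := mul_le_mul_of_nonneg_left (by nlinarith) hpos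
  · have hMn' : (K * T : ℝ) + 1 ≤ M := by exact_mod_cast hMn.le
    -- with this lead, missing the best arm with probability `1 / M` is costly enough
    obtain ⟨c, p, hc, h0, h1, hreg⟩ := MSB.exists_instance_of_few_plays hK σ hα₁ hM0 ties π
      (T := T) (Δ := σ * √((M : ℝ) * K * T) * M) (by positivity)
    refine ⟨MSB.twoPointInstance hK σ hα₁ c p hc h0 h1, rfl, fun _ h => absurd h (by omega), ?_⟩
    refine le_trans (ENNReal.ofReal_le_ofReal ?_) hreg
    have hM' : (0 : ℝ) < M := by positivity
    have hmiss : 1 ≤ M * (K * T * (1 - K * T / M) : ℝ) := by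
      have : M * (K * T * (1 - K * T / M) : ℝ) = K * T * (M - K * T) := by field_simp
      rw [this]
      nlinarith
    have hpos : 0 ≤ α₁ * (σ * √((M : ℝ) * K * T)) := by positivity
    calc 1 / 27 * α₁ * σ * √((M : ℝ) * K * T)
        ≤ α₁ * (σ * √((M : ℝ) * K * T)) * 1 := by nlinarith
      _ ≤ α₁ * (σ * √((M : ℝ) * K * T)) * (M * (K * T * (1 - K * T / M))) := by gcongr
      _ = _ := by ring
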